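/- For $k\ge 2$ let $F^{(k)}_m$ be the generalized Fibonacci numbers: $F^{(k)}_m=0$ for $0\le m\le k-2$, $F^{(k)}_{k-1}=1$, and $F^{(k)}_m=\sum_{i=1}^{k}F^{(k)}_{m-i}$ for $m\ge k$. For $i\ge 0$ put $f_k(i)=\sum_{m=k-1}^{i}F^{(k)}_m$ (so $f_k(i)=0$ for $i\le k-2$). For a given $n$ put $$g_k(j)=1+\sum_{\ell=2}^{j}f_k(n-\ell),\qquad h_k(\ell)=f_k(n)+\sum_{j=2}^{\ell}g_k(k+1-j).$$ **Theorem.** Let $n\ge k\ge 3$ be integers. Break a stick into $n$ pieces at $n-1$ independent points, each uniformly distributed on the stick. The probability that no choice of $k$ of the $n$ pieces can be arranged, in any order, as the sides of a nondegenerate simple $k$-gon in the plane equals $$\frac{n!}{f_{k-1}(k-2)\,f_{k-1}(k-1)\cdots f_{k-1}(n)\;h_{k-1}(2)\,h_{k-1}(3)\cdots h_{k-1}(k-2)},$$ where the factors $h_{k-1}(\ell)$ are absent for $k=3$. In particular, for $k=3$ the probability that some three of the $n$ pieces form a triangle is $1-n!\prod_{j=2}^{n}(F_{j+2}-1)^{-1}$,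 where $F_1=F_2=1$, $F_{j+2}=F_{j+1}+F_j$ are the Fibonacci numbers. -/

import Mathlib

namespace BrokenStick

/-- The generalized Fibonacci numbers `F_n^{(k)}` (meant for `k ≥ 1`): `0` for `n ≤ k - 2`, `1` for
`n = k - 1`, and the sum of the `k` preceding ones for `n ≥ k`. -/
def genFib (k n : ℕ) : ℕ :=
  if n + 2 ≤ k then 0
  else if n + 1 ≤ k then 1
  else ∑ i : Fin k, genFib k (n - (i + 1))
termination_by n
decreasing_by have := i.isLt; omega

/-- `f_k(i) = ∑_{m=k-1}^{i} F_m^{(k)}`; the sum is empty, so the value is `0`, for `i ≤ k - 2`. -/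
def f (k i : ℕ) : ℕ := ∑ m ∈ Finset.Icc (k - 1) i, genFib k m

/-- `g_k(j) = 1 + ∑_{ℓ=2}^{j} f_k(n-ℓ)`, used for `j ≤ n` only. -/
def g (n k j : ℕ) : ℕ := 1 + ∑ l ∈ Finset.Icc 2 j, f k (n - l)

/-- `h_k(ℓ) = f_k(n) + ∑_{j=2}^{ℓ} g_k(k+1-j)`, used for `ℓ ≤ k - 1` only. -/
def h (n k l : ℕ) : ℕ := f k n + ∑ j ∈ Finset.Icc 2 l, g n k (k + 1 - j)

/-- The marks on the stick `[0, L]` cut at the points `x`, in order: `0`, then the cut points sorted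
increasingly, then `L`. -/
noncomputable def marks (L : ℝ) {m : ℕ} (x : Fin m → ℝ) : Fin (m + 2) → ℝ :=
  Fin.cons (α := fun _ => ℝ) 0 (Fin.snoc (α := fun _ => ℝ) (x ∘ Tuple.sort x) L)

/-- The lengths of the `m + 1` pieces, from left to right, of the stick `[0, L]` cut at the `m`
points `x`. -/
noncomputable def pieces (L : ℝ) {m : ℕ} (x : Fin m → ℝ) (i : Fin (m + 1)) : ℝ :=
  marks L x i.succ - marks L x i.castSucc

/-- A polygon in the plane is simple if its vertices are distinct and two different edges meet at
most in common endpoints. -/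
def IsSimple {k : ℕ} (P : Polygon (EuclideanSpace ℝ (Fin 2)) k) : Prop :=
  Function.Injective P.vertices ∧
    ∀ i j : Fin k, i ≠ j →
      P.edgeSet ℝ i ∩ P.edgeSet ℝ j ⊆
        {P i, P (finRotate k i)} ∩ {P j, P (finRotate k j)}

/-- There is a nondegenerate simple `k`-gon in the plane whose consecutive side lengths are
`a 0, …, a (k - 1)`. -/
def FormsPolygon {k : ℕ} [NeZero k] (a : Fin k → ℝ) : Prop :=
  ∃ P : Polygon (EuclideanSpace ℝ (Fin 2)) k,
    IsSimple P ∧ P.HasNondegenerateVertices ℝ ∧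
      ∀ i : Fin k, dist (P i) (P (finRotate k i)) = a i

/-- Some `k` of the pieces with lengths `a`, put together in some order, form a `k`-gon. The
embedding `s` chooses both the pieces and their order around the polygon. -/
def SomeChoiceForms (k : ℕ) [NeZero k] {N : ℕ} (a : Fin N → ℝ) : Prop :=
  ∃ s : Fin k ↪ Fin N, FormsPolygon (fun i => a (s i))

end BrokenStick

/-! Positive lengths are the sides of a simple `k`-gon when the largest is less than the sum of the
others (a polygon inscribed in a circle, `formsPolygon_of_lt_sum`), and only if it is at most that
sum (`FormsPolygon.two_mul_le_sum`). Once the pieces are sorted, the best partners of a given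
longest piece are the `k - 1` just before it. So, up to a null set, no choice forms a polygon
exactly when every piece from the `k`-th on exceeds the sum of its `k - 1` predecessors.

The slacks of these inequalities, together with the successive differences of the first pieces, are
a unitriangular linear image of the sorted pieces. In terms of the slacks the stick length is a
positive combination whose coefficients `slackCoeff` are the values of `f` and `h` in the formula
(`sum_slackCoeff_mul`).

The bad event is thus a slice of a disjoint union of simplicial cones with unimodular matrices, one
for each pair (order of the `n - 1` cut points, order of the `n` pieces). Integrating over the stick
length turns slices into truncated cones, whose volumes are those of weighted simplices
(`volume_slice_mul`). The same computation for the cube of cut points has weights `1` and `(n - 1)!`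
cones; the quotient of the two is `n!` divided by the product of the coefficients
(`volume_slice_pieceSlackMatrix`). -/

namespace BrokenStick

/-! ### Side lengths of simple polygons. -/

open Finset


-- The other sides form a path joining the endpoints of side `j`. The weak inequality suffices, as
-- it is only played against strict ones.
open Fin.NatCast Fin.CommRing in
theorem FormsPolygon.two_mul_le_sum {k : ℕ} [NeZero k] {a : Fin k → ℝ} (h : FormsPolygon a)
    (j : Fin k) : 2 * a j ≤ ∑ i, a i := by
  obtain ⟨m, rfl⟩ := Nat.exists_eq_succ_of_ne_zero (NeZero.ne k)
  obtain ⟨P, -, -, hP⟩ := h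
  simp only [Nat.succ_eq_add_one, finRotate_apply] at hP
  let q : ℕ → EuclideanSpace ℝ (Fin 2) := fun i => P (j + ((i : ℕ) : Fin (m + 1)))
  have hq : ∀ i, dist (q i) (q (i + 1)) = a (j + (i : Fin (m + 1))) := by
    intro i
    rw [← hP]
    simp only [q, Nat.cast_add, Nat.cast_one, add_assoc]
  have hqk : q (m + 1) = q 0 := by simp [q]
  have hsum : ∑ i, a i = ∑ i ∈ range (m + 1), a (j + (i : Fin (m + 1))) := by
    rw [Finset.sum_range, ← Equiv.sum_comp (Equiv.addLeft j)]
    simp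
  have h1 := dist_le_Ico_sum_dist q (show 1 ≤ m + 1 by omega)
  rw [hqk, dist_comm] at h1
  have h0 := hq 0
  simp only [zero_add, Nat.cast_zero, add_zero] at h0
  rw [hsum, Finset.range_eq_Ico, Finset.sum_eq_sum_Ico_succ_bot (by omega)]
  simp only [hq] at h1
  simp only [zero_add, Nat.cast_zero, add_zero] at h1 ⊢
  linarith

theorem finRotate_finRotate_ne {k : ℕ} (hk : 3 ≤ k) (i : Fin k) :
    finRotate k (finRotate k i) ≠ i := by
  obtain ⟨m, rfl⟩ : ∃ m, k = m + 3 := ⟨k - 3, by omega⟩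
  rw [finRotate_apply, finRotate_apply, add_assoc]
  intro h
  have h2 : (1 + 1 : Fin (m + 3)) = 0 := by simpa using h
  have := congrArg Fin.val h2
  rw [Fin.val_add] at this
  simp [Nat.mod_eq_of_lt (show 2 < m + 3 by omega)] at this

/-- A polygon each of whose edges lies on a supporting line containing no further vertex is
simple. -/
theorem isSimple_of_supporting {k : ℕ} (hk : 3 ≤ k) (P : Polygon (EuclideanSpace ℝ (Fin 2)) k)
    (D : Fin k → EuclideanSpace ℝ (Fin 2) → ℝ)
    (hline : ∀ i x y (s : ℝ), D i (AffineMap.lineMap x y s) = (1 - s) * D i x + s * D i y)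
    (hnonneg : ∀ i p, 0 ≤ D i (P p))
    (hzero : ∀ i p, D i (P p) = 0 ↔ p = i ∨ p = finRotate k i) : IsSimple P := by
  refine ⟨?_, ?_⟩
  · intro p q hpq
    change P p = P q at hpq
    by_contra hne
    have h1 : p = finRotate k q :=
      (((hzero q p).1 (by rw [hpq]; exact (hzero q q).2 (Or.inl rfl))).resolve_left hne)
    have h2 : q = finRotate k p :=
      (((hzero p q).1 (by rw [← hpq]; exact (hzero p p).2 (Or.inl rfl))).resolve_left
        (Ne.symm hne))
    exact finRotate_finRotate_ne hk q (by rw [← h1, ← h2])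
  · have key : ∀ i j : Fin k, i ≠ j → ∀ x, x ∈ P.edgeSet ℝ i → x ∈ P.edgeSet ℝ j →
        x ∈ ({P j, P (finRotate k j)} : Set (EuclideanSpace ℝ (Fin 2))) := by
      rintro i j hij x ⟨r, -, rfl⟩ ⟨s, ⟨hs0, hs1⟩, hs⟩
      have hD : D i (AffineMap.lineMap (P i) (P (finRotate k i)) r) = 0 := by
        rw [hline, (hzero i i).2 (Or.inl rfl), (hzero i _).2 (Or.inr rfl)]
        simp
      rw [← hs] at hD ⊢
      rw [hline] at hD
      rcases hs0.eq_or_lt with rfl | hs0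
      · simp
      rcases hs1.eq_or_lt with rfl | hs1
      · simp
      -- `D i` is nonnegative at both ends of edge `j` and zero at an interior point, hence zero at
      -- both ends. Then the edges `i` and `j` share both endpoints, impossible for `3 ≤ k`.
      exfalso
      have e1 := mul_nonneg (sub_nonneg.2 hs1.le) (hnonneg i j)
      have e2 := mul_nonneg hs0.le (hnonneg i (finRotate k j))
      have z1 : (1 - s) * D i (P j) = 0 := by linarith
      have z2 : s * D i (P (finRotate k j)) = 0 := by linarith
      have z1' := (hzero i j).1 ((mul_eq_zero.1 z1).resolve_left (sub_pos.2 hs1).ne')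
      have z2' := (hzero i _).1 ((mul_eq_zero.1 z2).resolve_left hs0.ne')
      have h1 := z1'.resolve_left (Ne.symm hij)
      have h2 := z2'.resolve_right (fun h => hij ((finRotate k).injective h).symm)
      exact finRotate_finRotate_ne hk i (by rw [← h1, h2])
    rintro i j hij x ⟨hi, hj⟩
    exact ⟨key j i hij.symm x hj hi, key i j hij x hi hj⟩

/-- The radius (in the form `1 / (2 * t)`) of the circle around a cyclic polygon. -/
theorem exists_sum_arcsin {m : ℕ} (a : Fin m → ℝ) (b : ℝ) (hb : 0 < b)
    (hlt : b < ∑ i, a i) : ∃ t, 0 < t ∧ t * b ≤ 1 ∧ ∑ i, Real.arcsin (t * a i) < Real.pi ∧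
      Real.sin (∑ i, Real.arcsin (t * a i)) = t * b := by
  let A : ℝ → ℝ := fun t => ∑ i, Real.arcsin (t * a i)
  have hAc : Continuous A := by
    refine continuous_finsetSum _ fun i _ => Real.continuous_arcsin.comp (by fun_prop)
  have hA0 : A 0 = 0 := by simp [A]
  have hAd : HasDerivAt A (∑ i, a i) 0 := by
    refine HasDerivAt.fun_sum fun i _ => ?_
    have h1 : HasDerivAt (fun t : ℝ => t * a i) (a i) 0 := by
      simpa using (hasDerivAt_id (0 : ℝ)).mul_const (a i)
    have h2 := (Real.hasDerivAt_arcsin (x := (fun t : ℝ => t * a i) 0) (by simp) (by simp)).comp 0 h1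
    simpa [Function.comp_def] using h2
  have hGd : HasDerivAt (fun t => Real.sin (A t) - t * b) (∑ i, a i - b) 0 := by
    have h1 := hAd.sin
    have h2 : HasDerivAt (fun t : ℝ => t * b) b 0 := by
      simpa using (hasDerivAt_id (0 : ℝ)).mul_const b
    rw [hA0, Real.cos_zero, one_mul] at h1
    exact h1.sub h2
  have hpos : ∀ᶠ t in nhdsWithin (0 : ℝ) (Set.Ioi 0), 0 < Real.sin (A t) - t * b := by
    have h := (hasDerivAt_iff_tendsto_slope.1 hGd).mono_left
      (nhdsWithin_mono 0 (fun x (hx : 0 < x) => hx.ne'))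
    filter_upwards [h.eventually (lt_mem_nhds (sub_pos.2 hlt)), self_mem_nhdsWithin] with t ht ht0
    simp only [slope, hA0, vsub_eq_sub, Real.sin_zero, zero_mul, sub_zero, smul_eq_mul] at ht
    exact (pos_iff_pos_of_mul_pos ht).1 (inv_pos.2 ht0)
  have hlt' : ∀ᶠ t in nhdsWithin (0 : ℝ) (Set.Ioi 0), A t < Real.pi :=
    (hAc.continuousAt.eventually (gt_mem_nhds (by rw [hA0]; exact Real.pi_pos))).filter_mono
      nhdsWithin_le_nhds
  have hle : ∀ᶠ t in nhdsWithin (0 : ℝ) (Set.Ioi 0), t < 1 / b :=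
    (gt_mem_nhds (by positivity : (0 : ℝ) < 1 / b)).filter_mono nhdsWithin_le_nhds
  obtain ⟨u, hu, hupi, hub, hu0⟩ :=
    (hpos.and (hlt'.and (hle.and self_mem_nhdsWithin))).exists
  have hu0 : 0 < u := hu0
  -- Truncating at `π` makes `G` negative wherever `A t ≥ π` and `t > 0`, so the zero found below
  -- has `A t < π`.
  let G : ℝ → ℝ := fun t => Real.sin (min (A t) Real.pi) - t * b
  have hGc : Continuous G := by
    refine (Real.continuous_sin.comp (hAc.min continuous_const)).sub (by fun_prop)
  have hG1 : 0 ≤ G u := by simp only [G, min_eq_left hupi.le]; exact hu.le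
  have hG2 : G (1 / b) ≤ 0 := by
    simp only [G, one_div, inv_mul_cancel₀ hb.ne', sub_nonpos]
    exact Real.sin_le_one _
  obtain ⟨t, ⟨ht1, ht2⟩, ht⟩ := intermediate_value_Icc' hub.le hGc.continuousOn ⟨hG2, hG1⟩
  have ht0 : 0 < t := hu0.trans_le ht1
  have hsin : Real.sin (min (A t) Real.pi) = t * b := sub_eq_zero.1 ht
  have hApi : A t < Real.pi := by
    by_contra hge
    rw [min_eq_right (not_lt.1 hge), Real.sin_pi] at hsin
    have := mul_pos ht0 hb
    linarith
  rw [min_eq_left hApi.le] at hsin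
  refine ⟨t, ht0, ?_, hApi, hsin⟩
  calc t * b ≤ 1 / b * b := by gcongr
    _ = 1 := by field_simp

/-- Points on a circle of radius `R`, given by half their polar angles. -/
noncomputable def circlePolygon (R : ℝ) {k : ℕ} (θ : Fin k → ℝ) :
    Polygon (EuclideanSpace ℝ (Fin 2)) k :=
  ⟨fun i => !₂[R * Real.cos (2 * θ i), R * Real.sin (2 * θ i)]⟩

theorem dist_circlePolygon {R : ℝ} (hR : 0 ≤ R) {k : ℕ} (θ : Fin k → ℝ) (i j : Fin k) :
    dist (circlePolygon R θ i) (circlePolygon R θ j) = 2 * R * |Real.sin (θ i - θ j)| := by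
  rw [EuclideanSpace.dist_eq, Fin.sum_univ_two, Real.dist_eq, Real.dist_eq, sq_abs, sq_abs]
  rw [show 2 * R * |Real.sin (θ i - θ j)| = |2 * R * Real.sin (θ i - θ j)| by
    rw [abs_mul, abs_of_nonneg (by positivity : 0 ≤ 2 * R)], ← Real.sqrt_sq_eq_abs]
  congr 1
  simp only [circlePolygon, PiLp.toLp_apply, Matrix.cons_val_zero, Matrix.cons_val_one]
  have h1 : Real.cos (2 * (θ i - θ j)) = Real.cos (2 * θ i) * Real.cos (2 * θ j) +
      Real.sin (2 * θ i) * Real.sin (2 * θ j) := by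
    rw [← Real.cos_sub]; ring_nf
  have h2 : Real.cos (2 * (θ i - θ j)) = 1 - 2 * Real.sin (θ i - θ j) ^ 2 := by
    rw [Real.cos_two_mul, Real.cos_sq']; ring
  have h3 := Real.sin_sq_add_cos_sq (2 * θ i)
  have h4 := Real.sin_sq_add_cos_sq (2 * θ j)
  linear_combination R ^ 2 * h3 + R ^ 2 * h4 + 2 * R ^ 2 * h1 - 2 * R ^ 2 * h2

/-- The equation of the chord between half-angles `α` and `β`, evaluated at half-angle `γ`, factors
as `2R sin(γ - α) sin(γ - β)`. Both sines have the same sign except for the closing edge, where `ε`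
corrects the sign; so every edge line is supporting. -/
theorem isSimple_circlePolygon {R : ℝ} (hR : 0 < R) {m : ℕ} (hm : 2 ≤ m) (θ : Fin (m + 1) → ℝ)
    (hmono : StrictMono θ) (hpi : θ (Fin.last m) - θ 0 < Real.pi) :
    IsSimple (circlePolygon R θ) := by
  have hsin_pos : ∀ i j, i < j → 0 < Real.sin (θ j - θ i) := fun i j hij =>
    Real.sin_pos_of_pos_of_lt_pi (sub_pos.2 (hmono hij)) (lt_of_le_of_lt
      (sub_le_sub (hmono.monotone (Fin.le_last j)) (hmono.monotone (Fin.zero_le i))) hpi)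
  have hsin_neg : ∀ i j, i < j → Real.sin (θ i - θ j) < 0 := fun i j hij => by
    have := hsin_pos i j hij
    rw [← neg_sub, Real.sin_neg]
    linarith
  let S : Fin (m + 1) → Fin (m + 1) → ℝ := fun i p =>
    Real.sin (θ p - θ i) * Real.sin (θ p - θ (finRotate (m + 1) i))
  let ε : Fin (m + 1) → ℝ := fun i => if i = Fin.last m then -1 else 1
  let D : Fin (m + 1) → EuclideanSpace ℝ (Fin 2) → ℝ := fun i x =>
    ε i * (R * Real.cos (θ i - θ (finRotate (m + 1) i)) -
      x 0 * Real.cos (θ i + θ (finRotate (m + 1) i)) -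
      x 1 * Real.sin (θ i + θ (finRotate (m + 1) i)))
  have hD : ∀ i p, D i (circlePolygon R θ p) = 2 * R * (ε i * S i p) := by
    intro i p
    simp only [D, S, circlePolygon, Matrix.cons_val_zero, Matrix.cons_val_one]
    generalize θ (finRotate (m + 1) i) = β
    generalize θ i = α
    generalize θ p = γ
    have h1 : Real.cos (2 * γ) * Real.cos (α + β) + Real.sin (2 * γ) * Real.sin (α + β) =
        Real.cos ((γ - α) + (γ - β)) := by
      rw [← Real.cos_sub]; ring_nf
    have h2 : Real.cos (α - β) = Real.cos ((γ - α) - (γ - β)) := by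
      rw [← Real.cos_neg]; ring_nf
    rw [Real.cos_add (γ - α)] at h1
    rw [Real.cos_sub (γ - α)] at h2
    linear_combination ε i * R * h2 - ε i * R * h1
  have hS : ∀ i p, 0 ≤ ε i * S i p ∧ (p ≠ i → p ≠ finRotate (m + 1) i → ε i * S i p ≠ 0) := by
    intro i p
    rcases eq_or_ne i (Fin.last m) with rfl | hi
    · simp only [ε, if_true, S, finRotate_last]
      have h0 : p ≠ Fin.last m → p < Fin.last m := fun h => lt_of_le_of_ne (Fin.le_last p) h
      have h1 : p ≠ 0 → 0 < p := fun h => Fin.pos_iff_ne_zero.2 h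
      rcases eq_or_ne p (Fin.last m) with rfl | hp
      · simp
      rcases eq_or_ne p 0 with rfl | hp'
      · simp
      have := mul_pos_of_neg_of_neg (hsin_neg _ _ (h0 hp)) (neg_lt_zero.2 (hsin_pos _ _ (h1 hp')))
      constructor
      · linarith
      · intros; linarith
    · obtain ⟨i, rfl⟩ := Fin.exists_castSucc_eq.2 hi
      have hr : finRotate (m + 1) i.castSucc = i.succ := by
        rw [finRotate_apply, Fin.coeSucc_eq_succ]
      simp only [ε, if_neg hi, S, hr, one_mul]
      rcases lt_trichotomy p i.castSucc with hp | rfl | hp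
      · have := mul_pos_of_neg_of_neg (hsin_neg _ _ hp)
          (hsin_neg _ _ (hp.trans (Fin.castSucc_lt_succ)))
        exact ⟨this.le, fun _ _ => this.ne'⟩
      · simp
      · rcases (Fin.castSucc_lt_iff_succ_le.1 hp).eq_or_lt with rfl | hp'
        · simp
        · have := mul_pos (hsin_pos _ _ hp) (hsin_pos _ _ hp')
          exact ⟨this.le, fun _ _ => this.ne'⟩
  refine isSimple_of_supporting (by omega) _ D ?_ ?_ ?_
  · intro i x y s
    simp only [D, AffineMap.lineMap_apply, vsub_eq_sub, vadd_eq_add, PiLp.add_apply,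
      PiLp.smul_apply, PiLp.sub_apply, smul_eq_mul]
    ring
  · intro i p
    rw [hD]
    exact mul_nonneg (by positivity) (hS i p).1
  · intro i p
    rw [hD]
    constructor
    · intro h
      by_contra! hne
      exact (hS i p).2 hne.1 hne.2 ((mul_eq_zero.1 h).resolve_left (by positivity))
    · rintro (rfl | rfl) <;> simp [S]

/-- On a circle of radius `1 / (2t)` a chord of length `a` subtends the inscribed angle `arcsin (t
a)` or its supplement. Laying off the shorter sides one after another, the polygon closes with the
longest side by the choice of `t`. Distinct points on a circle are never collinear in threes. -/
theorem formsPolygon_of_lt_sum {m : ℕ} (hm : 2 ≤ m) (a : Fin (m + 1) → ℝ) (hpos : ∀ i, 0 < a i)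
    (hmax : ∀ i, a i ≤ a (Fin.last m)) (hlt : a (Fin.last m) < ∑ i : Fin m, a i.castSucc) :
    FormsPolygon a := by
  obtain ⟨t, ht0, ht1, hpi, hsin⟩ :=
    exists_sum_arcsin (fun i : Fin m => a i.castSucc) _ (hpos (Fin.last m)) hlt
  have hta : ∀ i, t * a i ≤ 1 := fun i => (mul_le_mul_of_nonneg_left (hmax i) ht0.le).trans ht1
  have hta0 : ∀ i, 0 < t * a i := fun i => mul_pos ht0 (hpos i)
  set α : Fin m → ℝ := fun i => Real.arcsin (t * a i.castSucc) with hα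
  let θ : Fin (m + 1) → ℝ := Fin.partialSum α
  have hθ0 : θ 0 = 0 := Fin.partialSum_zero α
  have hθs : ∀ i : Fin m, θ i.succ = θ i.castSucc + α i := Fin.partialSum_succ α
  have hθl : θ (Fin.last m) = ∑ i, α i := by
    simp only [θ, Fin.partialSum, Fin.val_last]
    rw [List.take_of_length_le (by simp), List.sum_ofFn]
  have hα0 : ∀ i, 0 < α i := fun i => Real.arcsin_pos.2 (hta0 _)
  have hmono : StrictMono θ := Fin.strictMono_iff_lt_succ.2 fun i => by
    rw [hθs]; linarith [hα0 i]
  have hR : 0 < 1 / (2 * t) := by positivity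
  have hsimple : IsSimple (circlePolygon (1 / (2 * t)) θ) :=
    isSimple_circlePolygon hR hm θ hmono (by rw [hθl, hθ0, sub_zero]; exact hpi)
  refine ⟨_, hsimple, ?_, ?_⟩
  · intro i
    obtain ⟨r, rfl⟩ : ∃ r, m = r + 2 := ⟨m - 2, by omega⟩
    have htwo : i + 2 = i + 1 + 1 := by
      rw [add_assoc i]
      congr 1
    refine EuclideanGeometry.Cospherical.affineIndependent_of_ne ⟨0, 1 / (2 * t), ?_⟩ ?_ ?_ ?_
    · have : ∀ j, dist (circlePolygon (1 / (2 * t)) θ j) 0 = 1 / (2 * t) := by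
        intro j
        rw [EuclideanSpace.dist_eq, Fin.sum_univ_two, Real.dist_eq, Real.dist_eq, sq_abs, sq_abs]
        simp only [circlePolygon, PiLp.toLp_apply, Matrix.cons_val_zero, Matrix.cons_val_one,
          PiLp.zero_apply, sub_zero]
        rw [mul_pow, mul_pow, ← mul_add, Real.cos_sq_add_sin_sq, mul_one, Real.sqrt_sq hR.le]
      rintro p (rfl | rfl | rfl) <;> exact this _
    · exact fun h => by simpa using hsimple.1 h
    · exact fun h => by
        have h := hsimple.1 h
        have h2 := finRotate_finRotate_ne (by omega) i
        rw [finRotate_apply, finRotate_apply, ← htwo] at h2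
        exact h2 h.symm
    · exact fun h => by
        have h := hsimple.1 h
        rw [htwo] at h
        simp at h
  · intro i
    rw [dist_circlePolygon hR.le]
    refine Fin.lastCases ?_ (fun j => ?_) i
    · rw [finRotate_last, hθ0, sub_zero, hθl, hsin, abs_of_pos (hta0 _)]
      field_simp
    · rw [finRotate_apply, Fin.coeSucc_eq_succ, hθs, sub_add_cancel_left, Real.sin_neg, abs_neg, hα,
        Real.sin_arcsin (by linarith [hta0 j.castSucc]) (hta _), abs_of_pos (hta0 _)]
      field_simp

end BrokenStick

/-! ### Generalized Fibonacci sums and the coefficients of the slacks. -/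

namespace BrokenStick

open Finset


theorem genFib_of_le {k n : ℕ} (h : n + 2 ≤ k) : genFib k n = 0 := by
  rw [genFib, if_pos h]

theorem genFib_pred {k : ℕ} (hk : 1 ≤ k) : genFib k (k - 1) = 1 := by
  rw [genFib, if_neg (by omega), if_pos (by omega)]

theorem genFib_of_ge {k n : ℕ} (h : k ≤ n) :
    genFib k n = ∑ p ∈ range k, genFib k (n - (p + 1)) := by
  rw [genFib, if_neg (by omega), if_neg (by omega), Finset.sum_range]

theorem f_eq_sum_range (k i : ℕ) : f k i = ∑ m ∈ range (i + 1), genFib k m := by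
  refine Finset.sum_subset (fun m hm => ?_) (fun m hm hm' => ?_)
  · simp only [mem_Icc, mem_range] at *; omega
  · simp only [mem_Icc, mem_range] at *
    exact genFib_of_le (by omega)

theorem f_succ (k i : ℕ) : f k (i + 1) = f k i + genFib k (i + 1) := by
  rw [f_eq_sum_range, f_eq_sum_range, Finset.sum_range_succ]

theorem f_of_lt {k i : ℕ} (h : i < k - 1) : f k i = 0 := by
  rw [f, Finset.Icc_eq_empty (by omega), Finset.sum_empty]

theorem f_recursion {k i : ℕ} (hk : 2 ≤ k) (hi : k - 1 ≤ i) :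
    f k i = 1 + ∑ p ∈ range k, f k (i - (p + 1)) := by
  induction i, hi using Nat.le_induction with
  | base =>
    rw [Finset.sum_eq_zero (fun p _ => f_of_lt (by omega))]
    simp [f, genFib_pred (show 1 ≤ k by omega)]
  | succ i hi ih =>
    rw [f_succ, ih, genFib_of_ge (by omega), add_assoc, ← Finset.sum_add_distrib]
    congr 1
    refine Finset.sum_congr rfl fun p hp => ?_
    rw [mem_range] at hp
    -- At `p = i` the truncated index `i - (p + 1)` does not shift; all terms involved are zero
    -- there.
    rcases (show p ≤ i by omega).eq_or_lt with rfl | hpi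
    · have h0 : f k 0 = 0 := f_of_lt (by omega)
      simp [h0, genFib_of_le (show 0 + 2 ≤ k by omega)]
    · rw [show i + 1 - (p + 1) = i - (p + 1) + 1 by omega, f_succ]

theorem f_pos {k i : ℕ} (hk : 2 ≤ k) (hi : k - 1 ≤ i) : 0 < f k i := by
  rw [f_recursion hk hi]; omega

theorem f_two (i : ℕ) : f 2 i + 1 = Nat.fib (i + 2) := by
  induction i using Nat.strong_induction_on with
  | _ i ih =>
    match i with
    | 0 => simp [f_of_lt (show 0 < 2 - 1 by norm_num)]
    | 1 => simp [f_recursion (k := 2) (i := 1), f_of_lt (show 0 < 2 - 1 by norm_num),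
        Nat.fib]
    | i + 2 =>
      rw [f_recursion le_rfl (by omega), Nat.fib_add_two, ← ih i (by omega), ← ih (i + 1) (by omega)]
      simp [sum_range_succ]
      omega

/-- The coefficient of the `j`-th slack variable in the length of the stick (`j` counts from `0`). -/
def slackCoeff (n k j : ℕ) : ℕ :=
  if j + 3 ≤ k then h n (k - 1) (k - 2 - j) else f (k - 1) (k + n - 3 - j)

theorem slackCoeff_of_lt {n k j : ℕ} (hj : j + 3 ≤ k) :
    slackCoeff n k j = h n (k - 1) (k - 2 - j) := if_pos hj

theorem slackCoeff_of_ge {n k j : ℕ} (hj : k < j + 3) :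
    slackCoeff n k j = f (k - 1) (k + n - 3 - j) := if_neg (by omega)

theorem h_one (n k : ℕ) : h n k 1 = f k n := by simp [h]

theorem h_succ {n k l : ℕ} (hl : 1 ≤ l) : h n k (l + 1) = h n k l + g n k (k - l) := by
  rw [h, h, ← Finset.insert_Icc_right_eq_Icc_add_one (by omega), Finset.sum_insert (by simp)]
  rw [show k + 1 - (l + 1) = k - l by omega]
  ring

theorem slackCoeff_pos {n k j : ℕ} (hk : 3 ≤ k) (hkn : k ≤ n) (hj : j < n) :
    0 < slackCoeff n k j := by
  unfold slackCoeff
  split_ifs with hjk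
  · have := f_pos (show 2 ≤ k - 1 by omega) (show k - 1 - 1 ≤ n by omega)
    rw [h]; omega
  · exact f_pos (by omega) (by omega)

/-- Vanishing past the last position lets the recursions below run over full windows without a
boundary case. -/
theorem slackCoeff_of_ge_length {n k j : ℕ} (hk : 3 ≤ k) (hkn : k ≤ n) (hj : n ≤ j) :
    slackCoeff n k j = 0 := by
  rw [slackCoeff_of_ge (by omega), f_of_lt (by omega)]

/-- This recursion and the next say that the `i`-th length has total coefficient `1` in the weighted
sum of slacks: the sums run over the other slacks from which it is subtracted. -/
theorem slackCoeff_eq_of_ge {n k i : ℕ} (hk : 3 ≤ k) (hi : k ≤ i + 2) (hin : i < n) :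
    slackCoeff n k i = 1 + ∑ j ∈ Ico (i + 1) (i + k), slackCoeff n k j := by
  rw [slackCoeff_of_ge (by omega), f_recursion (by omega) (by omega), Finset.sum_Ico_eq_sum_range,
    show i + k - (i + 1) = k - 1 by omega]
  congr 1
  refine Finset.sum_congr rfl fun p _ => ?_
  rw [slackCoeff_of_ge (by omega)]
  congr 1
  omega

theorem slackCoeff_eq_of_lt {n k i : ℕ} (hk : 3 ≤ k) (hkn : k ≤ n) (hi : i + 2 < k) :
    slackCoeff n k i =
      1 + slackCoeff n k (i + 1) + ∑ j ∈ Ico (k - 1) (i + k), slackCoeff n k j := by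
  have hsum : ∑ j ∈ Ico (k - 1) (i + k), slackCoeff n k j =
      ∑ q ∈ range (i + 1), f (k - 1) (n - (q + 2)) := by
    rw [Finset.sum_Ico_eq_sum_range, show i + k - (k - 1) = i + 1 by omega]
    refine Finset.sum_congr rfl fun p _ => ?_
    rw [slackCoeff_of_ge (by omega)]
    congr 1
    omega
  rw [hsum, slackCoeff_of_lt (by omega)]
  rcases (show i + 3 ≤ k by omega).eq_or_lt with hik | hik
  · rw [show k - 2 - i = 1 by omega, h_one, slackCoeff_of_ge (by omega),
      f_recursion (by omega) (by omega), show k - 1 = i + 1 + 1 by omega, Finset.sum_range_succ']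
    rw [show k + n - 3 - (i + 1) = n - (0 + 1) by omega]
    simp only [add_assoc]
    rw [add_comm (∑ _ ∈ _, _)]
  · rw [slackCoeff_of_lt (by omega), show k - 2 - i = (k - 2 - (i + 1)) + 1 by omega,
      h_succ (by omega), show k - 1 - (k - 2 - (i + 1)) = i + 2 by omega, g,
      ← Finset.Ico_succ_right_eq_Icc, Finset.sum_Ico_eq_sum_range]
    simp only [Nat.succ_eq_succ, Nat.succ_eq_add_one, show i + 2 + 1 - 2 = i + 1 by omega]
    rw [← add_assoc, add_comm (h _ _ _) 1]
    simp only [add_comm 2]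

theorem prod_slackCoeff {n k : ℕ} (hk : 3 ≤ k) (hkn : k ≤ n) :
    ∏ j ∈ range n, slackCoeff n k j =
      (∏ i ∈ Icc (k - 2) n, f (k - 1) i) * ∏ l ∈ Icc 2 (k - 2), h n (k - 1) l := by
  obtain ⟨r, rfl⟩ : ∃ r, k = r + 3 := ⟨k - 3, by omega⟩
  obtain ⟨q, rfl⟩ : ∃ q, n = r + (q + 3) := ⟨n - r - 3, by omega⟩
  rw [Finset.prod_range_add, mul_comm]
  congr 1
  · rw [← Finset.Ico_succ_right_eq_Icc, Finset.prod_Ico_eq_prod_range,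
      ← Finset.prod_range_reflect]
    rw [Nat.succ_eq_succ, show Nat.succ (r + (q + 3)) - (r + 3 - 2) = q + 3 by omega]
    refine Finset.prod_congr rfl fun j hj => ?_
    rw [mem_range] at hj
    -- Position `k - 3` has a coefficient of type `h`, but `h n (k - 1) 1` is the factor `f (k - 1)
    -- n`.
    rcases (show j ≤ q + 2 by omega).eq_or_lt with rfl | hj0
    · rw [slackCoeff_of_lt (by omega),
        show r + 3 - 2 - (r + (q + 3 - 1 - (q + 2))) = 1 by omega, h_one]
      congr 1
      omega
    · rw [slackCoeff_of_ge (by omega)]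
      congr 1
      omega
  · rw [← Finset.Ico_succ_right_eq_Icc, Finset.prod_Ico_eq_prod_range,
      ← Finset.prod_range_reflect]
    rw [Nat.succ_eq_succ, show Nat.succ (r + 3 - 2) - 2 = r by omega]
    refine Finset.prod_congr rfl fun j hj => ?_
    rw [mem_range] at hj
    rw [slackCoeff_of_lt (by omega)]
    congr 1
    omega

end BrokenStick

/-! ### Slacks of the sorted pieces and the polygon criterion. -/

namespace BrokenStick

open Finset


/-- The positions whose entries are subtracted from the entry at position `j` to form the `j`-th
slack: the preceding one if `j < k - 1`, and the `k - 1` preceding ones otherwise. -/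
def predSet (k : ℕ) {n : ℕ} (j : Fin n) : Finset (Fin n) :=
  univ.filter fun i => (j.val + 1 < k ∧ i.val + 1 = j.val) ∨
    (k ≤ j.val + 1 ∧ i < j ∧ j.val + 1 ≤ i.val + k)

theorem mem_predSet {k n : ℕ} {i j : Fin n} : i ∈ predSet k j ↔
    (j.val + 1 < k ∧ i.val + 1 = j.val) ∨ (k ≤ j.val + 1 ∧ i < j ∧ j.val + 1 ≤ i.val + k) := by
  simp [predSet]

theorem lt_of_mem_predSet {k n : ℕ} {i j : Fin n} (h : i ∈ predSet k j) : i < j := by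
  rw [mem_predSet] at h
  rcases h with h | h
  · exact Fin.lt_def.2 (by omega)
  · exact h.2.1

/-- The matrix that maps a tuple to its slacks. -/
def slackMatrix (k n : ℕ) : Matrix (Fin n) (Fin n) ℝ :=
  fun j i => if i = j then 1 else if i ∈ predSet k j then -1 else 0

open Matrix

theorem slackMatrix_mulVec (k : ℕ) {n : ℕ} (x : Fin n → ℝ) (j : Fin n) :
    (slackMatrix k n *ᵥ x) j = x j - ∑ i ∈ predSet k j, x i := by
  have h : ∀ i, slackMatrix k n j i * x i =
      (if i = j then x i else 0) - (if i ∈ predSet k j then x i else 0) := by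
    intro i
    unfold slackMatrix
    split_ifs with h1 h2
    · exact absurd (lt_of_mem_predSet h2) (by simp [h1])
    all_goals ring
  rw [mulVec, dotProduct, Finset.sum_congr rfl fun i _ => h i, Finset.sum_sub_distrib]
  simp

theorem det_slackMatrix (k n : ℕ) : (slackMatrix k n).det = 1 := by
  rw [det_of_isLowerTriangular]
  · simp [slackMatrix]
  · intro i j hij
    have hij : i < j := hij
    rw [slackMatrix, if_neg hij.ne', if_neg fun h => (lt_of_mem_predSet h).not_gt hij]

theorem sum_slackCoeff_mul {n k : ℕ} (hk : 3 ≤ k) (hkn : k ≤ n) (x : Fin n → ℝ) :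
    ∑ j : Fin n, (slackCoeff n k j : ℝ) * (slackMatrix k n *ᵥ x) j = ∑ i, x i := by
  have hcol : ∀ i : Fin n, (slackCoeff n k i : ℝ) =
      1 + ∑ j : Fin n, if i ∈ predSet k j then (slackCoeff n k j : ℝ) else 0 := by
    intro i
    have htop : ∀ a, ∑ j ∈ Ico a (i.val + k), slackCoeff n k j =
        ∑ j ∈ (range n).filter (fun j => a ≤ j ∧ j < i.val + k), slackCoeff n k j := by
      intro a
      symm
      refine Finset.sum_subset (fun j hj => ?_) (fun j hj hj' => ?_)
      · simp only [mem_filter, mem_Ico] at *; omega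
      · simp only [mem_filter, mem_Ico, mem_range] at *
        exact slackCoeff_of_ge_length hk hkn (by omega)
    have hnat : slackCoeff n k i = 1 + ∑ j ∈ range n, if (j + 1 < k ∧ i.val + 1 = j) ∨
        (k ≤ j + 1 ∧ i.val < j ∧ j + 1 ≤ i.val + k) then slackCoeff n k j else 0 := by
      rw [← Finset.sum_filter]
      rcases Nat.lt_or_ge (i.val + 2) k with hi | hi
      · rw [slackCoeff_eq_of_lt hk hkn hi, htop, add_assoc, ← Finset.sum_insert]
        · congr 1
          refine Finset.sum_congr ?_ fun _ _ => rfl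
          ext j
          simp only [mem_insert, mem_filter, mem_range]
          omega
        · simp only [mem_filter, mem_range]
          omega
      · rw [slackCoeff_eq_of_ge hk hi i.isLt, htop]
        congr 1
        refine Finset.sum_congr ?_ fun _ _ => rfl
        ext j
        simp only [mem_filter, mem_range]
        omega
    rw [hnat, Finset.sum_range]
    push_cast
    simp only [mem_predSet, Fin.lt_def]
  simp only [slackMatrix_mulVec, mul_sub, Finset.sum_sub_distrib, Finset.mul_sum]
  have hswap : ∑ j : Fin n, ∑ i ∈ predSet k j, (slackCoeff n k j : ℝ) * x i =
      ∑ i, (∑ j : Fin n, if i ∈ predSet k j then (slackCoeff n k j : ℝ) else 0) * x i := by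
    simp only [Finset.sum_mul, ite_mul, zero_mul]
    rw [Finset.sum_comm' (t' := univ) (s' := fun i => univ.filter fun j => i ∈ predSet k j)]
    · simp only [Finset.sum_filter]
    · simp
  rw [hswap, ← Finset.sum_sub_distrib]
  refine Finset.sum_congr rfl fun i _ => ?_
  rw [← sub_mul]
  nth_rewrite 1 [hcol i]
  ring

theorem slack_zero {k m : ℕ} (x : Fin (m + 1) → ℝ) :
    (slackMatrix k (m + 1) *ᵥ x) 0 = x 0 := by
  rw [slackMatrix_mulVec, Finset.sum_eq_zero, sub_zero]
  exact fun i hi => absurd (lt_of_mem_predSet hi) (Fin.not_lt_zero i)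

/-- For `k = m + 3` this covers every row after the first, so the same matrix also produces piece
lengths from sorted cut points in `cutMatrix`. -/
theorem slack_succ {k m : ℕ} (x : Fin (m + 1) → ℝ) (i : Fin m) (hi : i.val + 2 < k) :
    (slackMatrix k (m + 1) *ᵥ x) i.succ = x i.succ - x i.castSucc := by
  rw [slackMatrix_mulVec, show predSet k i.succ = {i.castSucc} from ?_, Finset.sum_singleton]
  ext j
  simp only [mem_predSet, mem_singleton, Fin.ext_iff, Fin.val_succ, Fin.val_castSucc]
  omega

/-- Induction on the position: the subtracted entries are already positive and include the immediate
predecessor. -/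
theorem pos_and_lt_of_slack_pos {k m : ℕ} (hk : 2 ≤ k) {x : Fin (m + 1) → ℝ}
    (hx : ∀ j, 0 < (slackMatrix k (m + 1) *ᵥ x) j) : (∀ j, 0 < x j) ∧ StrictMono x := by
  have hstep : ∀ i : Fin m, (∀ j < i.succ, 0 < x j) → x i.castSucc < x i.succ := by
    intro i hi
    have h := hx i.succ
    rw [slackMatrix_mulVec, sub_pos] at h
    refine lt_of_le_of_lt ?_ h
    refine Finset.single_le_sum (f := x) (fun j hj => (hi j (lt_of_mem_predSet hj)).le) ?_
    rw [mem_predSet, Fin.lt_def]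
    have h1 : i.castSucc.val = i.val := rfl
    have h2 : i.succ.val = i.val + 1 := rfl
    omega
  have hpos : ∀ j, 0 < x j := by
    intro j
    induction j using WellFoundedLT.induction with
    | _ j ih =>
      rcases Fin.eq_zero_or_eq_succ j with rfl | ⟨i, rfl⟩
      · simpa [slack_zero] using hx 0
      · exact (ih _ Fin.castSucc_lt_succ).trans (hstep i ih)
  exact ⟨hpos, Fin.strictMono_iff_lt_succ.2 fun i => hstep i fun j _ => hpos j⟩

theorem card_predSet {k n : ℕ} (hk : 1 ≤ k) {j : Fin n} (hj : k ≤ j.val + 1) :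
    (predSet k j).card = k - 1 := by
  have : predSet k j = Finset.Ico ⟨j.val + 1 - k, by omega⟩ j := by
    ext i
    simp only [mem_predSet, Finset.mem_Ico, Fin.le_def, Fin.lt_def]
    omega
  rw [this, Fin.card_Ico]
  simp only
  omega

/-- Exchange argument: `A \ B` and `B \ A` have equal size and are separated by the first position
`j + 1 - k` of the window `B`. -/
theorem sum_le_sum_predSet {k n : ℕ} (hk : 1 ≤ k) {x : Fin n → ℝ} (hx : Monotone x) {j : Fin n}
    {A : Finset (Fin n)} (hA : ∀ i ∈ A, i < j) (hcard : A.card = k - 1) (hj : k ≤ j.val + 1) :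
    ∑ i ∈ A, x i ≤ ∑ i ∈ predSet k j, x i := by
  set B := predSet k j with hB
  have hcardB : B.card = A.card := by rw [hcard, card_predSet hk hj]
  have hsd : (A \ B).card = (B \ A).card := Finset.card_sdiff_comm hcardB.symm
  have hjn := j.isLt
  have h1 : ∑ i ∈ A \ B, x i ≤ (A \ B).card • x ⟨j.val + 1 - k, by omega⟩ := by
    refine Finset.sum_le_card_nsmul _ _ _ fun i hi => hx ?_
    rw [mem_sdiff, hB, mem_predSet] at hi
    have h2 := hA i hi.1
    have h3 := hi.2
    rw [Fin.lt_def] at *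
    rw [Fin.le_def]
    simp only
    omega
  have h2 : (B \ A).card • x ⟨j.val + 1 - k, by omega⟩ ≤ ∑ i ∈ B \ A, x i := by
    refine Finset.card_nsmul_le_sum _ _ _ fun i hi => hx ?_
    rw [mem_sdiff, hB, mem_predSet] at hi
    have h3 := hi.1
    rw [Fin.le_def]
    simp only
    omega
  rw [← Finset.sum_inter_add_sum_sdiff A B, ← Finset.sum_inter_add_sum_sdiff B A,
    Finset.inter_comm B A]
  rw [hsd] at h1
  linarith

/-- The chosen piece that comes last in sorted order exceeds the sum of its `k - 1` predecessors,
hence that of the other chosen pieces. -/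
theorem not_someChoiceForms_of_lt {k n : ℕ} [NeZero k] {a : Fin n → ℝ} {σ : Equiv.Perm (Fin n)}
    (hmono : StrictMono (a ∘ σ))
    (h : ∀ j, k ≤ j.val + 1 → ∑ i ∈ predSet k j, (a ∘ σ) i < (a ∘ σ) j) :
    ¬ SomeChoiceForms k a := by
  rintro ⟨s, hs⟩
  have hk : 1 ≤ k := NeZero.one_le
  let e : Fin k ↪ Fin n := s.trans σ.symm.toEmbedding
  have he : ∀ i, a (s i) = (a ∘ σ) (e i) := fun i => by simp [e]
  obtain ⟨p, hp⟩ := Finite.exists_max e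
  have h2 := hs.two_mul_le_sum p
  simp only [he] at h2
  rw [← Finset.add_sum_erase _ _ (mem_univ p), two_mul, add_le_add_iff_left] at h2
  have hcard : ((univ.erase p).map e).card = k - 1 := by simp
  have hlt : ∀ i ∈ (univ.erase p).map e, i < e p := by
    intro i hi
    obtain ⟨q, hq, rfl⟩ := Finset.mem_map.1 hi
    exact lt_of_le_of_ne (hp q) (e.injective.ne (ne_of_mem_erase hq))
  have hj : k ≤ (e p).val + 1 := by
    have h3 : ((univ.erase p).map e).card ≤ (Finset.Iio (e p)).card :=
      Finset.card_le_card fun i hi => Finset.mem_Iio.2 (hlt i hi)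
    rw [hcard, Fin.card_Iio] at h3
    omega
  have h4 := sum_le_sum_predSet hk hmono.monotone hlt hcard hj
  rw [Finset.sum_map] at h4
  exact absurd (h2.trans h4) (not_le.2 (h _ hj))

theorem someChoiceForms_of_lt {k n : ℕ} [NeZero k] (hk : 3 ≤ k) {a : Fin n → ℝ}
    {σ : Equiv.Perm (Fin n)} (hmono : Monotone (a ∘ σ)) (hpos : ∀ i, 0 < a i) {j : Fin n}
    (hj : k ≤ j.val + 1) (h : (a ∘ σ) j < ∑ i ∈ predSet k j, (a ∘ σ) i) :
    SomeChoiceForms k a := by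
  obtain ⟨m, rfl⟩ : ∃ m, k = m + 1 := ⟨k - 1, by omega⟩
  have hjn := j.isLt
  -- The window of `k = m + 1` consecutive positions ending at `j`.
  let u : Fin (m + 1) → Fin n := fun i => ⟨j.val - m + i.val, by omega⟩
  have hu : StrictMono u := fun i i' hi => by
    rw [Fin.lt_def] at *
    simp only [u]
    omega
  have hul : u (Fin.last m) = j := by
    apply Fin.ext
    simp only [u, Fin.val_last]
    omega
  refine ⟨⟨σ ∘ u, σ.injective.comp hu.injective⟩, ?_⟩
  refine formsPolygon_of_lt_sum (by omega) _ (fun i => hpos _)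
    (fun i => hmono (hu.monotone (Fin.le_last i))) ?_
  have hsum : ∑ i : Fin m, (a ∘ σ) (u i.castSucc) = ∑ i ∈ predSet (m + 1) j, (a ∘ σ) i := by
    refine Finset.sum_bij (fun i _ => u i.castSucc) ?_ ?_ ?_ (fun _ _ => rfl)
    · intro i _
      rw [mem_predSet, Fin.lt_def]
      simp only [u, Fin.val_castSucc]
      omega
    · intro i _ i' _ hi
      exact Fin.castSucc_injective _ (hu.injective hi)
    · intro i hi
      rw [mem_predSet, Fin.lt_def] at hi
      refine ⟨⟨i.val - (j.val - m), by omega⟩, mem_univ _, Fin.ext ?_⟩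
      simp only [u, Fin.castSucc_mk]
      omega
  change (a ∘ σ) (u (Fin.last m)) < ∑ i : Fin m, (a ∘ σ) (u i.castSucc)
  rwa [hul, hsum]

end BrokenStick

/-! ### Volumes of slices of unions of simplicial cones. -/

namespace BrokenStick

open Finset Matrix MeasureTheory
open scoped ENNReal


/-- The permutation of `Fin (m + 1)` that extends `τ` and fixes the last element. -/
def extendLast {m : ℕ} (τ : Equiv.Perm (Fin m)) : Equiv.Perm (Fin (m + 1)) :=
  (finSuccEquivLast.trans (Equiv.optionCongr τ)).trans finSuccEquivLast.symm

theorem extendLast_last {m : ℕ} (τ : Equiv.Perm (Fin m)) :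
    extendLast τ (Fin.last m) = Fin.last m := by
  simp [extendLast]

theorem extendLast_castSucc {m : ℕ} (τ : Equiv.Perm (Fin m)) (i : Fin m) :
    extendLast τ i.castSucc = (τ i).castSucc := by
  simp [extendLast]

theorem snoc_comp_extendLast {m : ℕ} (τ : Equiv.Perm (Fin m)) (x : Fin m → ℝ) (L : ℝ) :
    Fin.snoc (α := fun _ => ℝ) x L ∘ extendLast τ = Fin.snoc (α := fun _ => ℝ) (x ∘ τ) L := by
  funext i
  refine Fin.lastCases ?_ (fun i => ?_) i
  · simp [extendLast_last]
  · simp [extendLast_castSucc]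

theorem continuous_snoc (m : ℕ) :
    Continuous fun p : ℝ × (Fin m → ℝ) => Fin.snoc (α := fun _ => ℝ) p.2 p.1 := by
  refine continuous_pi fun i => ?_
  refine Fin.lastCases ?_ (fun i => ?_) i
  · simp only [Fin.snoc_last]; fun_prop
  · simp only [Fin.snoc_castSucc]; fun_prop

theorem smul_snoc {m : ℕ} (r : ℝ) (x : Fin m → ℝ) (L : ℝ) :
    r • Fin.snoc (α := fun _ => ℝ) x L = Fin.snoc (α := fun _ => ℝ) (r • x) (r * L) := by
  funext i
  refine Fin.lastCases ?_ (fun i => ?_) i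
  · simp
  · simp

/-- The slice at height `L` of the union of the open simplicial cones described by `B`. -/
def slice {ι : Type*} {m : ℕ} (B : ι → Matrix (Fin (m + 1)) (Fin (m + 1)) ℝ) (L : ℝ) :
    Set (Fin m → ℝ) :=
  {x | ∃ i, ∀ j, 0 < (B i *ᵥ Fin.snoc (α := fun _ => ℝ) x L) j}

section Slice

variable {ι : Type*} {m : ℕ} {B : ι → Matrix (Fin (m + 1)) (Fin (m + 1)) ℝ}

theorem isOpen_cone (A : Matrix (Fin (m + 1)) (Fin (m + 1)) ℝ) :
    IsOpen {z : Fin (m + 1) → ℝ | ∀ j, 0 < (A *ᵥ z) j} := by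
  simp only [Set.ofPred_forall]
  refine isOpen_iInter_of_finite fun j => isOpen_lt continuous_const ?_
  exact (continuous_apply j).comp (continuous_const.matrix_mulVec continuous_id)

theorem measurableSet_slice (L : ℝ) : MeasurableSet (slice B L) := by
  have : slice B L = (fun x => Fin.snoc (α := fun _ => ℝ) x L) ⁻¹'
      ⋃ i, {z : Fin (m + 1) → ℝ | ∀ j, 0 < (B i *ᵥ z) j} := by
    ext x; simp [slice]
  rw [this]
  have hc : Continuous fun x : Fin m → ℝ => Fin.snoc (α := fun _ => ℝ) x L :=
    (continuous_snoc m).comp (by fun_prop : Continuous fun x : Fin m → ℝ => (L, x))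
  exact ((isOpen_iUnion fun i => isOpen_cone (B i)).preimage hc).measurableSet

theorem volume_slice_eq {L : ℝ} (hL : 0 < L) :
    volume (slice B L) = ENNReal.ofReal (L ^ m) * volume (slice B 1) := by
  have h : slice B 1 = (L • ·) ⁻¹' slice B L := by
    ext x
    simp only [slice, Set.mem_preimage, Set.mem_ofPred_eq]
    refine exists_congr fun i => forall_congr' fun j => ?_
    have := smul_snoc L x 1
    rw [mul_one] at this
    rw [← this, mulVec_smul, Pi.smul_apply, smul_eq_mul, mul_pos_iff_of_pos_left hL]
  rw [h, Measure.addHaar_preimage_smul _ hL.ne', ← mul_assoc, ← ENNReal.ofReal_mul (by positivity)]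
  simp [abs_of_pos hL, hL.ne']

/-- Both sides are the volume of the union of cones cut off at last coordinate `1`: the left by
Fubini and homogeneity of the slices, the right because each `B i` carries its cone, preserving
volume, onto the weighted simplex. The integral stays unevaluated since it cancels later. -/
theorem volume_slice_mul [Fintype ι] (hdet : ∀ i, |(B i).det| = 1)
    (hdisj : ∀ i i' z, (∀ j, 0 < (B i *ᵥ z) j) → (∀ j, 0 < (B i' *ᵥ z) j) → i = i')
    {c : Fin (m + 1) → ℝ} (hc : ∀ j, 0 < c j)
    (hsum : ∀ i z, ∑ j, c j * (B i *ᵥ z) j = z (Fin.last m)) :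
    volume (slice B 1) * ∫⁻ l in Set.Ioo (0 : ℝ) 1, ENNReal.ofReal (l ^ m) =
      Fintype.card ι * volume {y : Fin (m + 1) → ℝ | (∀ j, 0 < y j) ∧ ∑ j, c j * y j < 1} := by
  set S : Set (Fin (m + 1) → ℝ) := {y | (∀ j, 0 < y j) ∧ ∑ j, c j * y j < 1} with hS
  have hSm : MeasurableSet S := by
    have h1 : IsOpen {y : Fin (m + 1) → ℝ | ∀ j, 0 < y j} := by
      simp only [Set.ofPred_forall]
      exact isOpen_iInter_of_finite fun j => isOpen_lt continuous_const (continuous_apply j)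
    have h2 : IsOpen {y : Fin (m + 1) → ℝ | ∑ j, c j * y j < 1} :=
      isOpen_lt (by fun_prop) continuous_const
    exact (h1.inter h2).measurableSet
  let W : Set (Fin (m + 1) → ℝ) := ⋃ i, toLin' (B i) ⁻¹' S
  have hdet0 : ∀ i, LinearMap.det (toLin' (B i)) ≠ 0 := fun i h => by
    have := hdet i
    rw [LinearMap.det_toLin'] at h
    simp [h] at this
  have hWi : ∀ i, MeasurableSet (toLin' (B i) ⁻¹' S) := fun i =>
    hSm.preimage (LinearMap.continuous_of_finiteDimensional _).measurable
  have hW1 : volume W = Fintype.card ι * volume S := by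
    rw [measure_iUnion]
    · have : ∀ i, volume (toLin' (B i) ⁻¹' S) = volume S := fun i => by
        rw [Measure.addHaar_preimage_linearMap _ (hdet0 i), LinearMap.det_toLin', abs_inv, hdet]
        simp
      simp [this]
    · intro i i' hii
      refine Set.disjoint_left.2 fun z hz hz' => hii (hdisj i i' z hz.1 hz'.1)
    · exact hWi
  have hWmem : ∀ l x, Fin.snoc (α := fun _ => ℝ) x l ∈ W ↔ l ∈ Set.Ioo (0 : ℝ) 1 ∧ x ∈ slice B l := by
    intro l x
    simp only [W, S, slice, Set.mem_iUnion, Set.mem_preimage, Set.mem_ofPred_eq, toLin'_apply, hsum,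
      Fin.snoc_last, Set.mem_Ioo]
    constructor
    · rintro ⟨i, hi, hl⟩
      refine ⟨⟨?_, hl⟩, i, hi⟩
      have := hsum i (Fin.snoc (α := fun _ => ℝ) x l)
      rw [Fin.snoc_last] at this
      rw [← this]
      exact Finset.sum_pos (fun j _ => mul_pos (hc j) (hi j)) univ_nonempty
    · rintro ⟨⟨-, hl⟩, i, hi⟩
      exact ⟨i, hi, hl⟩
  have hW2 : volume W =
      volume (slice B 1) * ∫⁻ l in Set.Ioo (0 : ℝ) 1, ENNReal.ofReal (l ^ m) := by
    have hmp := (volume_preserving_piFinSuccAbove (fun _ : Fin (m + 1) => ℝ) (Fin.last m)).symm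
    have hWm : MeasurableSet W := MeasurableSet.iUnion hWi
    rw [← hmp.measure_preimage hWm.nullMeasurableSet, Measure.volume_eq_prod,
      Measure.prod_apply (hWm.preimage hmp.measurable), ← lintegral_const_mul _ (by fun_prop),
      ← lintegral_indicator measurableSet_Ioo]
    refine lintegral_congr fun l => ?_
    have : Prod.mk l ⁻¹' ((MeasurableEquiv.piFinSuccAbove (fun _ : Fin (m + 1) => ℝ)
        (Fin.last m)).symm ⁻¹' W) = {x | l ∈ Set.Ioo (0 : ℝ) 1 ∧ x ∈ slice B l} := by
      ext x
      rw [Set.mem_ofPred_eq, ← hWmem, ← Fin.insertNth_last']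
      rfl
    rw [this]
    by_cases hl : l ∈ Set.Ioo (0 : ℝ) 1
    · simp only [hl, true_and, Set.ofPred_mem_eq, Set.indicator_of_mem]
      rw [volume_slice_eq hl.1, mul_comm]
    · simp [hl]
  rw [← hW2, hW1]

theorem volume_weighted_simplex {c : Fin m → ℝ} (hc : ∀ j, 0 < c j) :
    ENNReal.ofReal (∏ j, c j) * volume {y : Fin m → ℝ | (∀ j, 0 < y j) ∧ ∑ j, c j * y j < 1} =
      volume {y : Fin m → ℝ | (∀ j, 0 < y j) ∧ ∑ j, y j < 1} := by
  have hprod : 0 < ∏ j, c j := Finset.prod_pos fun j _ => hc j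
  have h : {y : Fin m → ℝ | (∀ j, 0 < y j) ∧ ∑ j, c j * y j < 1} =
      toLin' (diagonal c) ⁻¹' {y : Fin m → ℝ | (∀ j, 0 < y j) ∧ ∑ j, y j < 1} := by
    ext y
    simp [mulVec_diagonal, mul_pos_iff_of_pos_left (hc _)]
  rw [h, Measure.addHaar_preimage_linearMap, LinearMap.det_toLin', det_diagonal, ← mul_assoc,
    abs_of_pos (inv_pos.2 hprod), ← ENNReal.ofReal_mul hprod.le, mul_inv_cancel₀ hprod.ne']
  · simp
  · rw [LinearMap.det_toLin', det_diagonal]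
    exact hprod.ne'

theorem volume_setOf_dotProduct_snoc_eq_zero {v : Fin (m + 1) → ℝ} (hv : v ≠ 0) {L : ℝ}
    (hL : L ≠ 0) : volume {x : Fin m → ℝ | v ⬝ᵥ Fin.snoc (α := fun _ => ℝ) x L = 0} = 0 := by
  have hexp : ∀ x : Fin m → ℝ, v ⬝ᵥ Fin.snoc (α := fun _ => ℝ) x L =
      (v ∘ Fin.castSucc) ⬝ᵥ x + v (Fin.last m) * L := fun x => by
    simp [dotProduct, Fin.sum_univ_castSucc]
  -- If only the last entry of `v` is nonzero the set is empty, because `L ≠ 0`; otherwise it is a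
  -- translate of a proper subspace.
  by_cases h0 : v ∘ Fin.castSucc = 0
  · have hl : v (Fin.last m) ≠ 0 := fun h => hv <| by
      funext i
      refine Fin.lastCases h (fun i => congrFun h0 i) i
    simp [hexp, h0, hl, hL]
  · let φ : (Fin m → ℝ) →ₗ[ℝ] ℝ := dotProductBilin ℝ ℝ (v ∘ Fin.castSucc)
    have hφ : φ ≠ 0 := fun h => h0 (dotProduct_eq_zero _ fun w => LinearMap.congr_fun h w)
    obtain ⟨x₀, hx₀⟩ := LinearMap.surjective hφ (v (Fin.last m) * L)
    have hset : {x : Fin m → ℝ | v ⬝ᵥ Fin.snoc (α := fun _ => ℝ) x L = 0} =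
        (fun x => x + x₀) ⁻¹' (LinearMap.ker φ : Set (Fin m → ℝ)) := by
      ext x
      simp only [Set.mem_ofPred_eq, hexp, Set.mem_preimage, SetLike.mem_coe, LinearMap.mem_ker,
        map_add, hx₀]
      rfl
    rw [hset, measure_preimage_add_right]
    exact Measure.addHaar_submodule _ _ fun h => hφ (LinearMap.ker_eq_top.1 h)

/-- This makes weak and strict cone inequalities interchangeable almost everywhere. -/
theorem ae_mulVec_snoc_ne_zero [Countable ι] (hdet : ∀ i, |(B i).det| = 1) {L : ℝ} (hL : L ≠ 0) :
    ∀ᵐ x : Fin m → ℝ, ∀ i j, (B i *ᵥ Fin.snoc (α := fun _ => ℝ) x L) j ≠ 0 := by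
  refine ae_all_iff.2 fun i => ae_all_iff.2 fun j => ?_
  have hrow : B i j ≠ 0 := fun h => by
    have := hdet i
    rw [det_eq_zero_of_row_eq_zero j fun q => congrFun h q] at this
    simp at this
  have := volume_setOf_dotProduct_snoc_eq_zero hrow hL
  rw [ae_iff]
  simpa [mulVec] using this

end Slice

end BrokenStick

/-! ### The cones of cut points and of slacks, and the probability. -/

namespace BrokenStick

open Finset Matrix MeasureTheory
open scoped ENNReal


theorem extendLast_injective (m : ℕ) : Function.Injective (extendLast (m := m)) := by
  intro τ τ' h
  ext i
  have := congrArg (fun σ : Equiv.Perm (Fin (m + 1)) => σ i.castSucc) h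
  simp only [extendLast_castSucc] at this
  exact congrArg Fin.val (Fin.castSucc_injective _ this)

theorem perm_eq_of_strictMono {n : ℕ} {z : Fin n → ℝ} {σ σ' : Equiv.Perm (Fin n)}
    (h : StrictMono (z ∘ σ)) (h' : StrictMono (z ∘ σ')) : σ = σ' := by
  have hz : Function.Injective z := by
    have := h.injective.comp σ.symm.injective
    rwa [Function.comp_assoc, Equiv.self_comp_symm, Function.comp_id] at this
  have := Tuple.unique_monotone h.monotone h'.monotone
  exact Equiv.ext fun i => hz (congrFun this i)

/-- The matrix that maps cut points, followed by the length of the stick, to the lengths of the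
pieces, provided that `τ` sorts the cut points. -/
noncomputable def cutMatrix (m : ℕ) (τ : Equiv.Perm (Fin m)) :
    Matrix (Fin (m + 1)) (Fin (m + 1)) ℝ :=
  slackMatrix (m + 3) (m + 1) * (extendLast τ).permMatrix ℝ

/-- The matrix that maps cut points, followed by the length of the stick, to the slacks of the
sorted pieces, provided that the first permutation sorts the cut points and the second one the
pieces. -/
noncomputable def pieceSlackMatrix (k m : ℕ) (p : Equiv.Perm (Fin m) × Equiv.Perm (Fin (m + 1))) :
    Matrix (Fin (m + 1)) (Fin (m + 1)) ℝ :=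
  slackMatrix k (m + 1) * (p.2.permMatrix ℝ * cutMatrix m p.1)

theorem cutMatrix_mulVec {m : ℕ} (τ : Equiv.Perm (Fin m)) (z : Fin (m + 1) → ℝ) :
    cutMatrix m τ *ᵥ z = slackMatrix (m + 3) (m + 1) *ᵥ (z ∘ extendLast τ) := by
  rw [cutMatrix, ← mulVec_mulVec, permMatrix_mulVec]

theorem pieceSlackMatrix_mulVec {k m : ℕ} (p : Equiv.Perm (Fin m) × Equiv.Perm (Fin (m + 1)))
    (z : Fin (m + 1) → ℝ) :
    pieceSlackMatrix k m p *ᵥ z = slackMatrix k (m + 1) *ᵥ ((cutMatrix m p.1 *ᵥ z) ∘ p.2) := by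
  rw [pieceSlackMatrix, ← mulVec_mulVec, ← mulVec_mulVec, permMatrix_mulVec]

theorem abs_det_permMatrix {n : ℕ} (σ : Equiv.Perm (Fin n)) : |(σ.permMatrix ℝ).det| = 1 := by
  rw [det_permutation, ← Int.cast_abs]
  simp

theorem abs_det_cutMatrix {m : ℕ} (τ : Equiv.Perm (Fin m)) : |(cutMatrix m τ).det| = 1 := by
  rw [cutMatrix, det_mul, det_slackMatrix, one_mul, abs_det_permMatrix]

theorem abs_det_pieceSlackMatrix {k m : ℕ} (p : Equiv.Perm (Fin m) × Equiv.Perm (Fin (m + 1))) :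
    |(pieceSlackMatrix k m p).det| = 1 := by
  rw [pieceSlackMatrix, det_mul, det_mul, det_slackMatrix, one_mul, abs_mul, abs_det_permMatrix,
    abs_det_cutMatrix, one_mul]

theorem cut_pos_and_strictMono {m : ℕ} {τ : Equiv.Perm (Fin m)} {z : Fin (m + 1) → ℝ}
    (h : ∀ j, 0 < (cutMatrix m τ *ᵥ z) j) :
    (∀ j, 0 < (z ∘ extendLast τ) j) ∧ StrictMono (z ∘ extendLast τ) := by
  rw [cutMatrix_mulVec] at h
  exact pos_and_lt_of_slack_pos (by omega) h

theorem cut_pos_of_pieceSlack_pos {k m : ℕ} (hk : 2 ≤ k)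
    {p : Equiv.Perm (Fin m) × Equiv.Perm (Fin (m + 1))} {z : Fin (m + 1) → ℝ}
    (h : ∀ j, 0 < (pieceSlackMatrix k m p *ᵥ z) j) :
    (∀ j, 0 < (cutMatrix m p.1 *ᵥ z) j) ∧ StrictMono ((cutMatrix m p.1 *ᵥ z) ∘ p.2) := by
  rw [pieceSlackMatrix_mulVec] at h
  obtain ⟨h1, h2⟩ := pos_and_lt_of_slack_pos hk h
  refine ⟨fun j => ?_, h2⟩
  simpa using h1 (p.2.symm j)

theorem cutMatrix_disjoint {m : ℕ} (τ τ' : Equiv.Perm (Fin m)) (z : Fin (m + 1) → ℝ)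
    (h : ∀ j, 0 < (cutMatrix m τ *ᵥ z) j) (h' : ∀ j, 0 < (cutMatrix m τ' *ᵥ z) j) : τ = τ' :=
  extendLast_injective m
    (perm_eq_of_strictMono (cut_pos_and_strictMono h).2 (cut_pos_and_strictMono h').2)

/-- A point of the cone determines the order of its cut points, hence the pieces, hence their order;
strictness makes both permutations unique. -/
theorem pieceSlackMatrix_disjoint {k m : ℕ} (hk : 2 ≤ k)
    (p p' : Equiv.Perm (Fin m) × Equiv.Perm (Fin (m + 1))) (z : Fin (m + 1) → ℝ)
    (h : ∀ j, 0 < (pieceSlackMatrix k m p *ᵥ z) j)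
    (h' : ∀ j, 0 < (pieceSlackMatrix k m p' *ᵥ z) j) : p = p' := by
  obtain ⟨h1, h2⟩ := cut_pos_of_pieceSlack_pos hk h
  obtain ⟨h1', h2'⟩ := cut_pos_of_pieceSlack_pos hk h'
  have hτ := cutMatrix_disjoint _ _ z h1 h1'
  rw [← hτ] at h2'
  exact Prod.ext hτ (perm_eq_of_strictMono h2 h2')

theorem sum_cutMatrix_mulVec {m : ℕ} (τ : Equiv.Perm (Fin m)) (z : Fin (m + 1) → ℝ) :
    ∑ j, (cutMatrix m τ *ᵥ z) j = z (Fin.last m) := by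
  rw [cutMatrix_mulVec]
  set w := z ∘ extendLast τ with hw
  have hs : ∀ i : Fin m, (slackMatrix (m + 3) (m + 1) *ᵥ w) i.succ = w i.succ - w i.castSucc :=
    fun i => slack_succ w i (by have := i.isLt; omega)
  have h1 := Fin.sum_univ_succ w
  have h2 := Fin.sum_univ_castSucc w
  rw [Fin.sum_univ_succ, slack_zero, Finset.sum_congr rfl fun i _ => hs i, Finset.sum_sub_distrib]
  have h3 : w (Fin.last m) = z (Fin.last m) := by simp [hw, extendLast_last]
  linarith

theorem sum_pieceSlackMatrix_mulVec {k m : ℕ} (hk : 3 ≤ k) (hkm : k ≤ m + 1)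
    (p : Equiv.Perm (Fin m) × Equiv.Perm (Fin (m + 1))) (z : Fin (m + 1) → ℝ) :
    ∑ j : Fin (m + 1), (slackCoeff (m + 1) k j : ℝ) * (pieceSlackMatrix k m p *ᵥ z) j =
      z (Fin.last m) := by
  rw [pieceSlackMatrix_mulVec, sum_slackCoeff_mul hk hkm, ← sum_cutMatrix_mulVec p.1 z]
  exact Equiv.sum_comp p.2 (cutMatrix m p.1 *ᵥ z)

theorem pieces_eq {m : ℕ} (L : ℝ) (x : Fin m → ℝ) :
    pieces L x = slackMatrix (m + 3) (m + 1) *ᵥ Fin.snoc (α := fun _ => ℝ) (x ∘ Tuple.sort x) L := by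
  funext i
  rcases Fin.eq_zero_or_eq_succ i with rfl | ⟨i, rfl⟩
  · rw [slack_zero]
    simp [pieces, marks]
  · rw [slack_succ _ _ (by have := i.isLt; omega), pieces, marks, Fin.cons_succ,
      ← Fin.succ_castSucc, Fin.cons_succ]

theorem pieces_eq_cutMatrix_mulVec {m : ℕ} {L : ℝ} {x : Fin m → ℝ} {τ : Equiv.Perm (Fin m)}
    (h : ∀ j, 0 < (cutMatrix m τ *ᵥ Fin.snoc (α := fun _ => ℝ) x L) j) :
    pieces L x = cutMatrix m τ *ᵥ Fin.snoc (α := fun _ => ℝ) x L := by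
  have h2 := (cut_pos_and_strictMono h).2
  rw [snoc_comp_extendLast] at h2
  have hmono : Monotone (x ∘ τ) := fun i j hij => by
    simpa using h2.monotone (Fin.castSucc_le_castSucc_iff.2 hij)
  rw [pieces_eq, cutMatrix_mulVec, snoc_comp_extendLast,
    Tuple.unique_monotone (Tuple.monotone_sort x) hmono]

theorem ae_mem_cube_iff {m : ℕ} {L : ℝ} (hL : 0 < L) :
    ∀ᵐ x : Fin m → ℝ, x ∈ (Set.univ.pi fun _ => Set.Icc 0 L) ↔ x ∈ slice (cutMatrix m) L := by
  filter_upwards [ae_mulVec_snoc_ne_zero (B := cutMatrix m) abs_det_cutMatrix hL.ne'] with x hx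
  constructor
  · intro hcube
    have hcube : ∀ i, 0 ≤ x i ∧ x i ≤ L := fun i => hcube i (Set.mem_univ i)
    refine ⟨Tuple.sort x, fun j => lt_of_le_of_ne ?_ (hx _ j).symm⟩
    rw [cutMatrix_mulVec, snoc_comp_extendLast, ← pieces_eq, pieces, sub_nonneg, marks]
    refine Fin.monotone_iff_le_succ.2 (fun i => ?_) (Fin.castSucc_le_succ j)
    have hsort := Tuple.monotone_sort x
    rcases Fin.eq_zero_or_eq_succ i with rfl | ⟨i, rfl⟩
    · simp only [Fin.castSucc_zero, Fin.cons_zero, Fin.cons_succ]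
      rcases m with _ | m
      · exact hL.le
      · rw [show (0 : Fin (m + 1 + 1)) = (0 : Fin (m + 1)).castSucc from rfl, Fin.snoc_castSucc]
        exact (hcube _).1
    · rw [← Fin.succ_castSucc, Fin.cons_succ, Fin.cons_succ, Fin.snoc_castSucc]
      rcases Fin.eq_castSucc_or_eq_last i.succ with ⟨i', hi'⟩ | hi'
      · rw [hi', Fin.snoc_castSucc]
        refine hsort ?_
        have := congrArg Fin.val hi'
        simp only [Fin.val_succ, Fin.val_castSucc] at this
        rw [Fin.le_def]
        omega
      · rw [hi', Fin.snoc_last]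
        exact (hcube _).2
  · rintro ⟨τ, hτ⟩ i -
    obtain ⟨h1, h2⟩ := cut_pos_and_strictMono hτ
    rw [snoc_comp_extendLast] at h1 h2
    have h3 := h1 (τ.symm i).castSucc
    have h4 := h2.monotone (Fin.le_last (τ.symm i).castSucc)
    simp only [Fin.snoc_castSucc, Fin.snoc_last, Function.comp_apply, Equiv.apply_symm_apply]
      at h3 h4
    exact ⟨h3.le, h4⟩

/-- Failure of all choices yields only nonnegative slacks; they are positive off the null set where
some slack vanishes. -/
theorem ae_not_someChoiceForms_iff {k m : ℕ} [NeZero k] (hk : 3 ≤ k) {L : ℝ} (hL : 0 < L) :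
    ∀ᵐ x : Fin m → ℝ, x ∈ slice (cutMatrix m) L ∧ ¬ SomeChoiceForms k (pieces L x) ↔
      x ∈ slice (pieceSlackMatrix k m) L := by
  filter_upwards [ae_mulVec_snoc_ne_zero (B := pieceSlackMatrix k m) abs_det_pieceSlackMatrix
    hL.ne'] with x hx
  constructor
  · rintro ⟨⟨τ, hτ⟩, hform⟩
    rw [pieces_eq_cutMatrix_mulVec hτ] at hform
    set a := cutMatrix m τ *ᵥ Fin.snoc (α := fun _ => ℝ) x L with ha
    have hsort := Tuple.monotone_sort a
    refine ⟨(τ, Tuple.sort a), fun j => lt_of_le_of_ne ?_ (hx _ j).symm⟩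
    rw [pieceSlackMatrix_mulVec, ← ha]
    simp only
    by_cases hj : k ≤ j.val + 1
    · rw [slackMatrix_mulVec, sub_nonneg]
      by_contra! hlt
      exact hform (someChoiceForms_of_lt hk hsort hτ hj hlt)
    · rcases Fin.eq_zero_or_eq_succ j with rfl | ⟨j, rfl⟩
      · rw [slack_zero]
        exact (hτ _).le
      · rw [Fin.val_succ] at hj
        rw [slack_succ _ _ (by omega), sub_nonneg]
        exact hsort (Fin.castSucc_le_succ j)
  · rintro ⟨p, hp⟩
    obtain ⟨h1, h2⟩ := cut_pos_of_pieceSlack_pos (by omega) hp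
    refine ⟨⟨p.1, h1⟩, ?_⟩
    rw [pieces_eq_cutMatrix_mulVec h1]
    refine not_someChoiceForms_of_lt h2 fun j _ => ?_
    have := hp j
    rwa [pieceSlackMatrix_mulVec, slackMatrix_mulVec, sub_pos] at this

theorem volume_slice_cutMatrix (m : ℕ) : volume (slice (cutMatrix m) 1) = 1 := by
  have h : (Set.univ.pi fun _ : Fin m => Set.Icc (0 : ℝ) 1) =ᵐ[volume] slice (cutMatrix m) 1 := by
    filter_upwards [ae_mem_cube_iff (m := m) one_pos] with x hx
    exact propext hx
  rw [← measure_congr h, volume_pi_pi]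
  simp

/-- `volume_slice_mul` is applied to `m! (m + 1)!` slack cones and to the `m!` cut cones, whose
slice has volume `1`. Comparison eliminates both the simplex volume and the integral `κ`, which need
only be nonzero and finite. -/
theorem volume_slice_pieceSlackMatrix {k m : ℕ} (hk : 3 ≤ k) (hkm : k ≤ m + 1) :
    ENNReal.ofReal (∏ j : Fin (m + 1), (slackCoeff (m + 1) k j : ℝ)) *
      volume (slice (pieceSlackMatrix k m) 1) = (m + 1).factorial := by
  have hc : ∀ j : Fin (m + 1), (0 : ℝ) < slackCoeff (m + 1) k j := fun j =>
    Nat.cast_pos.2 (slackCoeff_pos hk hkm j.isLt)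
  have h1 := volume_slice_mul (B := pieceSlackMatrix k m) abs_det_pieceSlackMatrix
    (pieceSlackMatrix_disjoint (by omega)) hc (sum_pieceSlackMatrix_mulVec hk hkm)
  have h2 := volume_slice_mul (B := cutMatrix m) abs_det_cutMatrix cutMatrix_disjoint
    (c := fun _ => 1) (fun _ => one_pos) (by simpa using sum_cutMatrix_mulVec)
  simp only [one_mul] at h2
  rw [← volume_weighted_simplex hc, volume_slice_cutMatrix, one_mul] at h2
  set κ := ∫⁻ l in Set.Ioo (0 : ℝ) 1, ENNReal.ofReal (l ^ m) with hκ
  have hκ0 : κ ≠ 0 := by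
    refine ((setLIntegral_pos_iff (by fun_prop)).2 ?_).ne'
    have : Set.Ioo (0 : ℝ) 1 ⊆ Function.support (fun l : ℝ => ENNReal.ofReal (l ^ m)) ∩
        Set.Ioo 0 1 := fun l hl => ⟨(ENNReal.ofReal_pos.2 (pow_pos hl.1 m)).ne', hl⟩
    exact lt_of_lt_of_le (by simp) (measure_mono this)
  have hκ1 : κ ≠ ⊤ := by
    refine (lt_of_le_of_lt (b := ∫⁻ l in Set.Ioo (0 : ℝ) 1, 1) ?_ (by simp)).ne
    refine setLIntegral_mono measurable_const fun l hl => ?_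
    exact ENNReal.ofReal_le_one.2 (pow_le_one₀ hl.1.le hl.2.le)
  rw [Fintype.card_prod, Fintype.card_perm, Fintype.card_perm, Fintype.card_fin,
    Fintype.card_fin] at h1
  rw [Fintype.card_perm, Fintype.card_fin] at h2
  refine (ENNReal.mul_left_inj hκ0 hκ1).1 ?_
  rw [mul_assoc, h1]
  conv_rhs => rw [h2]
  push_cast
  ring

open ProbabilityTheory in
theorem pi_cond_eq {m : ℕ} {s : Set ℝ} (hs : MeasurableSet s) (h0 : volume s ≠ 0)
    (h1 : volume s ≠ ⊤) :
    Measure.pi (fun _ : Fin m => cond volume s) =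
      cond (volume : Measure (Fin m → ℝ)) (Set.univ.pi fun _ => s) := by
  have := cond_isProbabilityMeasure_of_finite h0 h1
  refine Measure.pi_eq fun t ht => ?_
  rw [cond_apply (MeasurableSet.univ_pi fun _ => hs), ← Set.pi_inter_distrib, volume_pi_pi,
    volume_pi_pi, ENNReal.prod_inv_distrib, ← Finset.prod_mul_distrib]
  · simp only [cond_apply hs]
  · intro i _ j _ _
    exact Or.inl h0

open ProbabilityTheory in
theorem probability_not_someChoiceForms {k m : ℕ} [NeZero k] (hk : 3 ≤ k) (hkm : k ≤ m + 1)
    {Ω : Type*} [MeasurableSpace Ω] (μ : Measure Ω) [IsProbabilityMeasure μ] {L : ℝ} (hL : 0 < L)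
    (X : Fin m → Ω → ℝ) (hunif : ∀ i, pdf.IsUniform (X i) (Set.Icc 0 L) μ)
    (hindep : iIndepFun X μ) :
    NullMeasurableSet {ω | ¬ SomeChoiceForms k (pieces L (fun i => X i ω))} μ ∧
      μ.real {ω | ¬ SomeChoiceForms k (pieces L (fun i => X i ω))} =
        ((m + 1).factorial : ℝ) / ∏ j : Fin (m + 1), (slackCoeff (m + 1) k j : ℝ) := by
  have hI0 : volume (Set.Icc 0 L) ≠ 0 := by simp [hL]
  have hI1 : volume (Set.Icc 0 L) ≠ ⊤ := by simp
  have hX : ∀ i, AEMeasurable (X i) μ := fun i => (hunif i).aemeasurable hI0 hI1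
  have hXm : AEMeasurable (fun ω i => X i ω) μ := aemeasurable_pi_lambda _ hX
  set C : Set (Fin m → ℝ) := Set.univ.pi fun _ => Set.Icc 0 L with hC
  have hCm : MeasurableSet C := MeasurableSet.univ_pi fun _ => measurableSet_Icc
  have hmap : μ.map (fun ω i => X i ω) = cond volume C := by
    rw [(iIndepFun_iff_map_fun_eq_pi_map hX).1 hindep, ← pi_cond_eq measurableSet_Icc hI0 hI1]
    congr 1
    funext i
    exact hunif i
  set N : Set (Fin m → ℝ) := {x | ¬ SomeChoiceForms k (pieces L x)} with hN
  have hac : ∀ᵐ x ∂(cond volume C), x ∈ C := by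
    rw [ProbabilityTheory.cond]
    exact (ae_restrict_mem hCm).filter_mono (Measure.ae_smul_measure_le _)
  have hae : ∀ᵐ x ∂(cond volume C), x ∈ N ↔ x ∈ slice (pieceSlackMatrix k m) L := by
    filter_upwards [hac, cond_absolutelyContinuous.ae_le (ae_mem_cube_iff (m := m) hL),
      cond_absolutelyContinuous.ae_le (ae_not_someChoiceForms_iff (m := m) hk hL)] with x h1 h2 h3
    exact ⟨fun h => h3.1 ⟨h2.1 h1, h⟩, fun h => (h3.2 h).2⟩
  have haeμ : (fun ω i => X i ω) ⁻¹' N =ᵐ[μ]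
      (fun ω i => X i ω) ⁻¹' slice (pieceSlackMatrix k m) L := by
    rw [← hmap] at hae
    filter_upwards [ae_of_ae_map hXm hae] with ω hω
    exact propext hω
  have hsub : (C ∩ slice (pieceSlackMatrix k m) L : Set (Fin m → ℝ)) =ᵐ[volume]
      slice (pieceSlackMatrix k m) L := by
    filter_upwards [ae_mem_cube_iff (m := m) hL, ae_not_someChoiceForms_iff (m := m) hk hL]
      with x h2 h3
    exact propext ⟨fun h => h.2, fun h => ⟨h2.2 (h3.2 h).1, h⟩⟩
  have hprod : 0 < ∏ j : Fin (m + 1), (slackCoeff (m + 1) k j : ℝ) :=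
    Finset.prod_pos fun j _ => Nat.cast_pos.2 (slackCoeff_pos hk hkm j.isLt)
  have hμ : μ ((fun ω i => X i ω) ⁻¹' N) = volume (slice (pieceSlackMatrix k m) 1) := by
    have hLm : ENNReal.ofReal (L ^ m) ≠ 0 := (ENNReal.ofReal_pos.2 (pow_pos hL m)).ne'
    have hvol : volume C = ENNReal.ofReal (L ^ m) := by
      rw [hC, volume_pi_pi]
      simp [ENNReal.ofReal_pow hL.le]
    rw [measure_congr haeμ, ← Measure.map_apply_of_aemeasurable hXm (measurableSet_slice L), hmap,
      cond_apply hCm, measure_congr hsub, volume_slice_eq hL, hvol, ← mul_assoc,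
      ENNReal.inv_mul_cancel hLm ENNReal.ofReal_ne_top, one_mul]
  -- Measurability is inherited from the slice, with which the event agrees almost surely.
  refine ⟨(hXm.nullMeasurableSet_preimage (measurableSet_slice L)).congr haeμ.symm, ?_⟩
  change (μ ((fun ω i => X i ω) ⁻¹' N)).toReal = _
  have h := congrArg ENNReal.toReal (volume_slice_pieceSlackMatrix hk hkm)
  rw [← hμ, ENNReal.toReal_mul, ENNReal.toReal_ofReal hprod.le, ENNReal.toReal_natCast] at h
  rw [eq_div_iff hprod.ne', mul_comm, h]

end BrokenStick

/-! ### The theorem and the triangle case. -/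

theorem theorem1 (n k : ℕ) [NeZero k] (hk : 3 ≤ k) (hkn : k ≤ n)
    {Ω : Type*} [MeasurableSpace Ω] (μ : MeasureTheory.Measure Ω)
    [MeasureTheory.IsProbabilityMeasure μ]
    (L : ℝ) (hL : 0 < L)
    (X : Fin (n - 1) → Ω → ℝ)
    (hunif : ∀ i, MeasureTheory.pdf.IsUniform (X i) (Set.Icc 0 L) μ)
    (hindep : ProbabilityTheory.iIndepFun X μ) :
    MeasureTheory.NullMeasurableSet
        {ω | ¬ BrokenStick.SomeChoiceForms k (BrokenStick.pieces L (fun i => X i ω))} μ ∧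
      μ.real {ω | ¬ BrokenStick.SomeChoiceForms k (BrokenStick.pieces L (fun i => X i ω))} =
        (n.factorial : ℝ) /
          ((∏ i ∈ Finset.Icc (k - 2) n, (BrokenStick.f (k - 1) i : ℝ)) *
            ∏ l ∈ Finset.Icc 2 (k - 2), (BrokenStick.h n (k - 1) l : ℝ)) ∧
      (k = 3 →
        μ.real {ω | BrokenStick.SomeChoiceForms k (BrokenStick.pieces L (fun i => X i ω))} =
          1 - (n.factorial : ℝ) * ∏ j ∈ Finset.Icc 2 n, ((Nat.fib (j + 2) : ℝ) - 1)⁻¹) := by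
  obtain ⟨m, rfl⟩ : ∃ m, n = m + 1 := ⟨n - 1, by omega⟩
  obtain ⟨hnull, hprob⟩ :=
    BrokenStick.probability_not_someChoiceForms (m := m) hk hkn μ hL X hunif hindep
  have hprod : ∏ j : Fin (m + 1), (BrokenStick.slackCoeff (m + 1) k j : ℝ) =
      (∏ i ∈ Finset.Icc (k - 2) (m + 1), (BrokenStick.f (k - 1) i : ℝ)) *
        ∏ l ∈ Finset.Icc 2 (k - 2), (BrokenStick.h (m + 1) (k - 1) l : ℝ) := by
    have := BrokenStick.prod_slackCoeff hk hkn
    rw [Finset.prod_range] at this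
    exact_mod_cast this
  rw [hprod] at hprob
  refine ⟨hnull, hprob, ?_⟩
  rintro rfl
  have hcompl := MeasureTheory.probReal_compl_eq_one_sub₀ hnull
  rw [Set.compl_ofPred] at hcompl
  simp only [not_not] at hcompl
  refine hcompl.trans ?_
  congr 1
  refine hprob.trans ?_
  rw [div_eq_mul_inv]
  congr 1
  rw [Finset.Icc_eq_empty_of_lt (show 3 - 2 < 2 by norm_num), Finset.prod_empty, mul_one,
    Finset.prod_inv_distrib, Finset.Icc_eq_cons_Ioc (show 3 - 2 ≤ m + 1 by omega),
    Finset.prod_cons]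
  have hfib : ∀ i, (BrokenStick.f (3 - 1) i : ℝ) = (Nat.fib (i + 2) : ℝ) - 1 := fun i => by
    rw [← BrokenStick.f_two]
    simp
  simp only [hfib]
  -- The split-off factor `i = 1` equals `2 - 1 = 1`, so the product may start at `2`.
  rw [show Nat.fib (3 - 2 + 2) = 2 from rfl,
    show Finset.Ioc (3 - 2) (m + 1) = Finset.Icc 2 (m + 1) from rfl]
  norm_num
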